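/- Let $d\ge 2$ and let $\eta$ be a stationary Poisson point process of intensity $1$ in $\mathbf R^d$. For a locally finite set $\chi\subset\mathbf R^d$, two distinct points of $\chi$ are joined by an edge of the Delaunay graph of $\chi$ if they are among the vertices of a $d$-simplex with vertices in $\chi$ whose open circumball contains no point of $\chi$; let $d_\chi(x)$ be the degree of $x\in\chi$ in this graph. For a Borel set $B\subset\mathbf R^d$ put $M^B_\chi=\max_{x\in\chi\cap B}d_\chi(x)$, with $M^B_\chi=-\infty$ if $\chi\cap B=\varnothing$. Write $|B|$ for the Lebesgue measure of $B$. The typical degree $\mathcal D^0$ is the integer-valued random variable with distribution $$\mathbb P(\mathcal D^0=j)=\frac1{|B_0|}\,\mathbb E\Big[\sum_{x\in\eta\cap B_0}\mathbf 1\{d_\eta(x)=j\}\Big],\qquad j=0,1,2,\dots,$$ where $B_0\subset\mathbf R^d$ is any fixed Borel set with $0<|B_0|<\infty$ (the choice of $B_0$ does not matter). Proposition. For every Borel set $B\subset\mathbf R^d$ with $0<|B|<\infty$, every integer $k\ge 0$ and every real $h\ge 1$, $$\mathbb P\big(M^B_\eta\ge k\big)\ \ge\ \frac{|B|}{h+1}\left(\mathbb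 P\big(\mathcal D^0\ge k\big)-\exp\Big(-|B|\Big(1-e+\frac h{|B|}\Big)\Big)\right).$$ -/

import Mathlib

open MeasureTheory ProbabilityTheory
open scoped ENNReal

namespace PoissonDelaunay

/-- `χ ⊆ ℝ^d` is locally finite: every bounded set contains finitely many points of `χ`. -/
def LocallyFiniteSet {d : ℕ} (χ : Set (EuclideanSpace ℝ (Fin d))) : Prop :=
  ∀ K : Set (EuclideanSpace ℝ (Fin d)), Bornology.IsBounded K → (χ ∩ K).Finite

/-- `η` is a stationary Poisson point process of intensity `1` in `ℝ^d`, seen as a random locally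
finite set: the number of points in a Borel set `A` is a random variable, which has the Poisson
distribution with parameter `|A|` if `|A| < ∞`, and the numbers of points in pairwise disjoint Borel
sets are independent. -/
structure IsUnitPoissonProcess {d : ℕ} {Ω : Type*} [MeasurableSpace Ω]
    (η : Ω → Set (EuclideanSpace ℝ (Fin d))) (P : Measure Ω) : Prop where
  locallyFinite : ∀ ω, LocallyFiniteSet (η ω)
  measurable_count : ∀ A : Set (EuclideanSpace ℝ (Fin d)), MeasurableSet A →
    Measurable fun ω => (η ω ∩ A).encard
  law_count : ∀ A : Set (EuclideanSpace ℝ (Fin d)), MeasurableSet A → volume A ≠ ∞ →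
    ∀ n : ℕ, P {ω | (η ω ∩ A).encard = n} = poissonMeasure (volume A).toNNReal {n}
  indep_count : ∀ (m : ℕ) (A : Fin m → Set (EuclideanSpace ℝ (Fin d))),
    (∀ i, MeasurableSet (A i)) → Pairwise (Function.onFun Disjoint A) →
      iIndepFun (fun i ω => (η ω ∩ A i).encard) P

/-- The Delaunay graph of `χ`: two distinct points are joined by an edge if they are vertices of a
`d`-simplex with vertices in `χ` whose open circumball contains no point of `χ`. The graph is
carried by the whole space; points outside `χ` are isolated. -/
def delaunayGraph {d : ℕ} (χ : Set (EuclideanSpace ℝ (Fin d))) :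
    SimpleGraph (EuclideanSpace ℝ (Fin d)) where
  Adj x y := x ≠ y ∧ ∃ s : Affine.Simplex ℝ (EuclideanSpace ℝ (Fin d)) d,
    (∀ i, s.points i ∈ χ) ∧ χ ∩ Metric.ball s.circumcenter s.circumradius = ∅ ∧
      (∃ i, s.points i = x) ∧ ∃ j, s.points j = y
  symm := ⟨fun _ _ ⟨hne, s, hs, he, hx, hy⟩ => ⟨hne.symm, s, hs, he, hy, hx⟩⟩
  loopless := ⟨fun _ h => h.1 rfl⟩

/-- The degree `d_χ(x)`: the number of neighbours of `x` in the Delaunay graph of `χ`. -/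
noncomputable def degree {d : ℕ} (χ : Set (EuclideanSpace ℝ (Fin d)))
    (x : EuclideanSpace ℝ (Fin d)) : ℕ∞ :=
  ((delaunayGraph χ).neighborSet x).encard

/-- The maximal degree `M_χ^B` over the points of `χ` in `B`; it is `⊥` (that is, `-∞`) if there
are none. -/
noncomputable def maxDegree {d : ℕ} (χ B : Set (EuclideanSpace ℝ (Fin d))) : WithBot ℕ∞ :=
  ⨆ x ∈ χ ∩ B, (degree χ x : WithBot ℕ∞)

/-- The distribution of the typical degree `D⁰`, as a measure on `ℕ`, computed from a Borel set
`B₀` with `0 < |B₀| < ∞`: the point `j` has mass `|B₀|⁻¹ E[∑_{x ∈ η ∩ B₀} 1{d_η(x) = j}]`. -/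
noncomputable def typicalDegreeLaw {d : ℕ} {Ω : Type*} [MeasurableSpace Ω]
    (η : Ω → Set (EuclideanSpace ℝ (Fin d))) (P : Measure Ω)
    (B₀ : Set (EuclideanSpace ℝ (Fin d))) : Measure ℕ :=
  Measure.sum fun j : ℕ =>
    ((volume B₀)⁻¹ * ∫⁻ ω, ∑' x : ↥(η ω ∩ B₀),
      Set.indicator {y | degree (η ω) y = (j : ℕ∞)} (fun _ => (1 : ℝ≥0∞)) x.1 ∂P) •
        Measure.dirac j

end PoissonDelaunay

/-! Let `N` be the number of points of `η` in `B` and let `Z ≤ N` count those of degree at least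
`k`. If `Z > 0` then `maxDegree ≥ k`, so truncating at `h + 1` gives `E Z ≤ (h + 1) P(maxDegree ≥ k)
+ E[N 1{N > h + 1}]` (`degreeCount_le_add`, `degreeIntensity_Ici_le`).

Lower bound for `E Z`: the measure `A ↦ E #{x ∈ η ∩ A : degree ≥ k}` is translation invariant,
because `η` is stationary and the Delaunay graph commutes with translations. It is finite on compact
sets, hence equals `c • volume` (`exists_degreeIntensity_eq`), and evaluating it on `B₀` gives `c ≥
P(D⁰ ≥ k)` (`typicalDegreeLaw_Ici_le`).

Upper bound for the tail: for a Poisson variable of mean `r`, `E[N 1{N > h + 1}] = r P(N > h)`, and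
Chernoff's bound with exponent `1` gives `r exp(r (e - 1) - h)`
(`lintegral_poissonMeasure_tail_le`).

Most of the work is measurability of the degree and the passage from the laws of counts to the law
of the whole process, which yields stationarity. -/

namespace PoissonDelaunay

/-! ### Measurability of sums and existential statements over the points of a point process. -/

section Configurations

variable {d : ℕ} {S : Type*} [MeasurableSpace S]

local notation "X" => EuclideanSpace ℝ (Fin d)

lemma LocallyFiniteSet.countable {χ : Set X} (h : LocallyFiniteSet χ) : χ.Countable := by
  have : χ = ⋃ n : ℕ, χ ∩ Metric.ball 0 n := by
    rw [← Set.inter_iUnion, Metric.iUnion_ball_nat, Set.inter_univ]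
  rw [this]
  exact Set.countable_iUnion fun n => (h _ Metric.isBounded_ball).countable

lemma LocallyFiniteSet.preimage_add {χ : Set X} (h : LocallyFiniteSet χ) (v : X) :
    LocallyFiniteSet ((v + ·) ⁻¹' χ) := by
  intro K hK
  have h1 : (χ ∩ (v + ·) '' K).Finite := by
    apply h
    exact hK.vadd v
  refine Set.Finite.of_finite_image (h1.subset ?_) (add_right_injective v).injOn
  rintro _ ⟨x, ⟨hx, hxK⟩, rfl⟩
  exact ⟨hx, x, hxK, rfl⟩

/-- A family of locally finite sets for which the number of points in each bounded Borel set is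
measurable. -/
structure IsPointProcess (η : S → Set X) : Prop where
  locallyFinite : ∀ s, LocallyFiniteSet (η s)
  measurable_count : ∀ A : Set X, MeasurableSet A → Bornology.IsBounded A →
    Measurable fun s => (η s ∩ A).encard

lemma IsPointProcess.comp {η : S → Set X} (hη : IsPointProcess η) {T : Type*} [MeasurableSpace T]
    {f : T → S} (hf : Measurable f) : IsPointProcess fun t => η (f t) :=
  ⟨fun _ => hη.locallyFinite _, fun A hA hb => (hη.measurable_count A hA hb).comp hf⟩

/-- The shell of points whose norm has integer part `n`. -/
def shell (d n : ℕ) : Set (EuclideanSpace ℝ (Fin d)) := {x | ⌊‖x‖⌋₊ = n}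

lemma measurableSet_shell (d n : ℕ) : MeasurableSet (shell d n) :=
  (Nat.measurable_floor.comp measurable_norm) (measurableSet_singleton n)

lemma isBounded_shell (d n : ℕ) : Bornology.IsBounded (shell d n) := by
  refine (Metric.isBounded_ball (x := 0) (r := n + 1)).subset fun x hx => ?_
  rw [mem_ball_zero_iff, ← (show ⌊‖x‖⌋₊ = n from hx)]
  exact Nat.lt_floor_add_one _

lemma pairwise_disjoint_shell (d : ℕ) : Pairwise (Function.onFun Disjoint (shell d)) := by
  intro m n hmn
  exact Set.disjoint_left.2 fun x hm hn => hmn (hm.symm.trans hn)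

lemma iUnion_shell (d : ℕ) : ⋃ n, shell d n = Set.univ :=
  Set.eq_univ_of_forall fun _ => Set.mem_iUnion.2 ⟨_, rfl⟩

lemma sum_restrict_shell (μ : Measure X) : Measure.sum (fun n => μ.restrict (shell d n)) = μ := by
  rw [← Measure.restrict_iUnion (pairwise_disjoint_shell d) (measurableSet_shell d), iUnion_shell,
    Measure.restrict_univ]

/-- The counting measure of a set of points. -/
noncomputable def pointMeasure (χ : Set X) : Measure X := Measure.count.restrict χ

lemma pointMeasure_apply (χ : Set X) (hχ : χ.Countable) {A : Set X} (hA : MeasurableSet A) :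
    pointMeasure χ A = ((χ ∩ A).encard : ℝ≥0∞) := by
  rw [pointMeasure, Measure.restrict_apply hA, Measure.count_apply (hA.inter hχ.measurableSet),
    Set.inter_comm]

lemma lintegral_pointMeasure {χ : Set X} (hχ : χ.Countable) (f : X → ℝ≥0∞) :
    ∫⁻ x, f x ∂pointMeasure χ = ∑' x : χ, f x := by
  rw [pointMeasure, lintegral_countable _ hχ]
  simp

/-- Cutting along shells reduces an arbitrary Borel set to bounded ones, the only sets whose counts
are assumed measurable. -/
lemma IsPointProcess.measurable_pointMeasure {η : S → Set X} (hη : IsPointProcess η) :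
    Measurable fun s => pointMeasure (η s) := by
  refine Measure.measurable_of_measurable_coe _ fun A hA => ?_
  have key : ∀ s, pointMeasure (η s) A = ∑' n, ((η s ∩ (A ∩ shell d n)).encard : ℝ≥0∞) := by
    intro s
    conv_lhs => rw [← sum_restrict_shell (pointMeasure (η s))]
    rw [Measure.sum_apply _ hA]
    refine tsum_congr fun n => ?_
    rw [Measure.restrict_apply hA,
      pointMeasure_apply _ (hη.locallyFinite s).countable (hA.inter (measurableSet_shell d n))]
  simp_rw [key]
  refine Measurable.tsum fun n => ?_
  exact (Measurable.of_discrete (f := fun k : ℕ∞ => (k : ℝ≥0∞))).comp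
    (hη.measurable_count _ (hA.inter (measurableSet_shell d n))
      ((isBounded_shell d n).subset Set.inter_subset_right))

/-- The counting measures of a point process, as a kernel. -/
noncomputable def IsPointProcess.kernel {η : S → Set X} (hη : IsPointProcess η) : Kernel S X where
  toFun s := pointMeasure (η s)
  measurable' := hη.measurable_pointMeasure

lemma IsPointProcess.kernel_apply {η : S → Set X} (hη : IsPointProcess η) (s : S) :
    hη.kernel s = pointMeasure (η s) := rfl

/-- S-finiteness makes integrals against the kernel measurable in the parameter. Counts in a shell
are finite but not uniformly bounded in `s`, so the kernel is split both by the shell `n` and by the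
exact count `m` there; the `(n, m)` piece has mass at most `m`. -/
lemma IsPointProcess.isSFiniteKernel {η : S → Set X} (hη : IsPointProcess η) :
    IsSFiniteKernel hη.kernel := by
  classical
  have hm : ∀ n m : ℕ, MeasurableSet {s | (η s ∩ shell d n).encard = m} := fun n m =>
    (hη.measurable_count _ (measurableSet_shell d n) (isBounded_shell d n))
      (measurableSet_singleton (m : ℕ∞))
  have hval : ∀ s n, (hη.kernel.restrict (measurableSet_shell d n) s) Set.univ
      = ((η s ∩ shell d n).encard : ℝ≥0∞) := by
    intro s n
    rw [Kernel.restrict_apply, Measure.restrict_apply_univ, hη.kernel_apply,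
      pointMeasure_apply _ (hη.locallyFinite s).countable (measurableSet_shell d n)]
  let κ : ℕ → ℕ → Kernel S X := fun n m =>
    Kernel.piecewise (hm n m) (hη.kernel.restrict (measurableSet_shell d n)) 0
  have hfin : ∀ n m, IsFiniteKernel (κ n m) := by
    intro n m
    refine ⟨⟨m, by simp, fun s => ?_⟩⟩
    by_cases hs : (η s ∩ shell d n).encard = m
    · simp only [κ, Kernel.piecewise_apply, Set.mem_ofPred_eq, hs, if_true, hval]
      simp
    · simp [κ, Kernel.piecewise_apply, hs]
  have hsum : hη.kernel = Kernel.sum fun n => Kernel.sum (κ n) := by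
    ext1 s
    rw [Kernel.sum_apply, hη.kernel_apply]
    conv_lhs => rw [← sum_restrict_shell (pointMeasure (η s))]
    congr 1
    ext1 n
    rw [Kernel.sum_apply]
    obtain ⟨m, hm'⟩ : ∃ m : ℕ, (η s ∩ shell d n).encard = m :=
      ⟨_, ((hη.locallyFinite s _ (isBounded_shell d n)).cast_ncard_eq).symm⟩
    ext1 A hA
    rw [Measure.sum_apply _ hA, tsum_eq_single m]
    · simp only [κ, Kernel.piecewise_apply, Set.mem_ofPred_eq, hm', if_true]
      rw [Kernel.restrict_apply, hη.kernel_apply]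
    · intro m' hne
      have : ¬ (η s ∩ shell d n).encard = m' := by
        rw [hm']; exact_mod_cast hne.symm
      simp [κ, Kernel.piecewise_apply, this]
  rw [hsum]
  have : ∀ n, IsSFiniteKernel (Kernel.sum (κ n)) := fun n => inferInstance
  infer_instance

lemma IsPointProcess.measurable_tsum {η : S → Set X} (hη : IsPointProcess η)
    {f : S → X → ℝ≥0∞} (hf : Measurable (Function.uncurry f)) :
    Measurable fun s => ∑' x : η s, f s x := by
  have := hη.isSFiniteKernel
  have := Measurable.lintegral_kernel_prod_right' (κ := hη.kernel) hf
  simpa only [hη.kernel_apply, lintegral_pointMeasure (hη.locallyFinite _).countable,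
    Function.uncurry_apply_pair] using this

/-- A suitable point exists exactly when the sum of the indicators over the points is nonzero. -/
lemma IsPointProcess.measurableSet_exists {η : S → Set X} (hη : IsPointProcess η)
    {G : Set (S × X)} (hG : MeasurableSet G) : MeasurableSet {s | ∃ x ∈ η s, (s, x) ∈ G} := by
  have h1 := hη.measurable_tsum (f := fun s x => G.indicator 1 (s, x))
    (measurable_one.indicator hG)
  have h2 : {s | ∃ x ∈ η s, (s, x) ∈ G} =
      {s | ∑' x : η s, G.indicator 1 (s, (x : X)) = (0 : ℝ≥0∞)}ᶜ := by
    ext s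
    simp only [Set.mem_ofPred_eq, Set.mem_compl_iff, ENNReal.tsum_eq_zero, Subtype.forall,
      Set.indicator_apply_eq_zero, Pi.one_apply, one_ne_zero, imp_false]
    push Not
    simp
  rw [h2]
  exact (h1 (measurableSet_singleton 0)).compl

/-- The induction moves the first point of the tuple into the parameter space, so the parameter
space `S` must vary with the step. -/
lemma IsPointProcess.measurableSet_exists_tuple {m : ℕ} :
    ∀ {S : Type*} [MeasurableSpace S] {η : S → Set X}, IsPointProcess η →
    ∀ {G : Set (S × (Fin m → X))}, MeasurableSet G →
      MeasurableSet {s | ∃ z : Fin m → X, (∀ i, z i ∈ η s) ∧ (s, z) ∈ G} := by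
  induction m with
  | zero =>
    intro S _ η hη G hG
    have : {s | ∃ z : Fin 0 → X, (∀ i, z i ∈ η s) ∧ (s, z) ∈ G}
        = (fun s => (s, (Fin.elim0 : Fin 0 → X))) ⁻¹' G := by
      ext s
      simp only [Set.mem_ofPred_eq, Set.mem_preimage]
      constructor
      · rintro ⟨z, -, hz⟩
        rwa [Subsingleton.elim z Fin.elim0] at hz
      · intro hz
        exact ⟨_, fun i => i.elim0, hz⟩
    rw [this]
    exact measurable_prodMk_right hG
  | succ m ih =>
    intro S _ η hη G hG
    have hcons : Measurable fun p : (S × X) × (Fin m → X) =>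
        (p.1.1, (Fin.cons p.1.2 p.2 : Fin (m + 1) → X)) := by
      refine (measurable_fst.comp measurable_fst).prodMk (measurable_pi_lambda _ fun i => ?_)
      refine Fin.cases ?_ (fun j => ?_) i
      · simp only [Fin.cons_zero]
        fun_prop
      · simp only [Fin.cons_succ]
        fun_prop
    have h1 := ih (hη.comp (measurable_fst (β := X))) (hcons hG)
    convert! hη.measurableSet_exists h1 using 1
    ext s
    simp only [Set.mem_ofPred_eq, Set.mem_preimage]
    constructor
    · rintro ⟨z, hz, hG⟩
      exact ⟨z 0, hz 0, Fin.tail z, fun i => hz i.succ, by rwa [Fin.cons_self_tail]⟩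
    · rintro ⟨x, hx, z, hz, hG⟩
      exact ⟨Fin.cons x z, fun i => Fin.cases hx hz i, hG⟩

end Configurations

/-! ### Measurability and translation covariance of the Delaunay degree. -/

section Delaunay

variable {d : ℕ}

local notation "X" => EuclideanSpace ℝ (Fin d)

/-- `w` lies in an open ball whose boundary passes through all the points `z i`. -/
def InCircumball (z : Fin (d + 1) → X) (w : X) : Prop :=
  ∃ c, (∀ i, dist (z i) c = dist (z 0) c) ∧ dist w c < dist (z 0) c

lemma _root_.AffineIndependent.eq_circumcenter_of_forall_dist_eq {z : Fin (d + 1) → X}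
    (hz : AffineIndependent ℝ z) {c : X} (hc : ∀ i, dist (z i) c = dist (z 0) c) :
    c = (⟨z, hz⟩ : Affine.Simplex ℝ X d).circumcenter := by
  refine Affine.Simplex.eq_circumcenter_of_dist_eq _ ?_ hc
  have : affineSpan ℝ (Set.range z) = ⊤ := by
    rw [hz.affineSpan_eq_top_iff_card_eq_finrank_add_one]
    simp
  simp [this]

lemma inCircumball_iff {z : Fin (d + 1) → X} (hz : AffineIndependent ℝ z) (w : X) :
    InCircumball z w ↔ w ∈ Metric.ball (⟨z, hz⟩ : Affine.Simplex ℝ X d).circumcenter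
      (⟨z, hz⟩ : Affine.Simplex ℝ X d).circumradius := by
  have hr := (⟨z, hz⟩ : Affine.Simplex ℝ X d).dist_circumcenter_eq_circumradius
  rw [Metric.mem_ball]
  constructor
  · rintro ⟨c, hc, hw⟩
    obtain rfl := hz.eq_circumcenter_of_forall_dist_eq hc
    rwa [← hr 0]
  · intro hw
    exact ⟨_, fun i => (hr i).trans (hr 0).symm, by rwa [← hr 0] at hw⟩

/-- This form quantifies only over tuples and points of `χ`, as the measurability lemmas for point
processes require. -/
lemma delaunayGraph_adj_iff {χ : Set X} {x y : X} :
    (delaunayGraph χ).Adj x y ↔ ∃ z : Fin (d + 1) → X, (∀ i, z i ∈ χ) ∧ x ≠ y ∧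
      AffineIndependent ℝ z ∧ (∀ w ∈ χ, ¬ InCircumball z w) ∧ (∃ i, z i = x) ∧ ∃ j, z j = y := by
  constructor
  · rintro ⟨hne, s, hs, he, hx, hy⟩
    refine ⟨s.points, hs, hne, s.independent, fun w hw hin => ?_, hx, hy⟩
    rw [inCircumball_iff s.independent] at hin
    exact Set.eq_empty_iff_forall_notMem.1 he w ⟨hw, hin⟩
  · rintro ⟨z, hz, hne, hi, he, hx, hy⟩
    refine ⟨hne, ⟨z, hi⟩, hz, ?_, hx, hy⟩
    refine Set.eq_empty_iff_forall_notMem.2 fun w ⟨hw, hin⟩ => he w hw ?_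
    rwa [inCircumball_iff hi]

lemma delaunayGraph_adj_preimage_add (χ : Set X) (v x y : X) :
    (delaunayGraph ((v + ·) ⁻¹' χ)).Adj x y ↔ (delaunayGraph χ).Adj (v + x) (v + y) := by
  have hball : ∀ (u : X) (z : Fin (d + 1) → X) (w : X),
      InCircumball z w → InCircumball (fun i => u + z i) (u + w) := by
    rintro u z w ⟨c, hc, hw⟩
    exact ⟨u + c, by simpa using hc, by simpa using hw⟩
  have hind : ∀ (u : X) (z : Fin (d + 1) → X),
      AffineIndependent ℝ z → AffineIndependent ℝ (fun i => u + z i) := by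
    intro u z hz
    exact hz.map' (AffineEquiv.constVAdd ℝ X u).toAffineMap (AffineEquiv.injective _)
  simp only [delaunayGraph_adj_iff]
  constructor
  · rintro ⟨z, hz, hne, hi, he, ⟨i, rfl⟩, ⟨j, rfl⟩⟩
    refine ⟨fun i => v + z i, hz, by simpa using hne, hind v z hi, fun w hw hin => ?_,
      ⟨i, rfl⟩, ⟨j, rfl⟩⟩
    refine he (-v + w) (by simpa using hw) ?_
    simpa using hball (-v) _ _ hin
  · rintro ⟨z, hz, hne, hi, he, ⟨i, hx⟩, ⟨j, hy⟩⟩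
    refine ⟨fun i => -v + z i, by simpa using hz, by simpa using hne, hind _ z hi,
      fun w hw hin => ?_, ⟨i, by simp [hx]⟩, ⟨j, by simp [hy]⟩⟩
    refine he (v + w) hw ?_
    simpa using hball v _ _ hin

lemma degree_preimage_add (χ : Set X) (v x : X) :
    degree ((v + ·) ⁻¹' χ) x = degree χ (v + x) := by
  have : (delaunayGraph χ).neighborSet (v + x)
      = (v + ·) '' (delaunayGraph ((v + ·) ⁻¹' χ)).neighborSet x := by
    ext y
    simp only [SimpleGraph.mem_neighborSet, Set.image_add_left, Set.mem_preimage,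
      delaunayGraph_adj_preimage_add, add_neg_cancel_left]
  rw [degree, degree, this, (add_right_injective v).encard_image]

lemma neighborSet_subset (χ : Set X) (x : X) : (delaunayGraph χ).neighborSet x ⊆ χ := by
  intro y hy
  obtain ⟨z, hz, -, -, -, -, j, rfl⟩ := delaunayGraph_adj_iff.1 hy
  exact hz j

/-- The set is a projection along the centre `c`. Affine independence makes the centre unique, so
the projection is injective on a Borel set and its image is Borel by the Lusin–Souslin theorem. -/
lemma measurableSet_inCircumball :
    MeasurableSet {p : (Fin (d + 1) → X) × X | AffineIndependent ℝ p.1 ∧ InCircumball p.1 p.2} := by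
  let T : Set (((Fin (d + 1) → X) × X) × X) := {p | AffineIndependent ℝ p.1.1 ∧
    (∀ i, dist (p.1.1 i) p.2 = dist (p.1.1 0) p.2) ∧ dist p.1.2 p.2 < dist (p.1.1 0) p.2}
  have hT : MeasurableSet T := by
    refine MeasurableSet.inter ?_ (MeasurableSet.inter ?_ ?_)
    · exact ((isOpen_setOfPred_affineIndependent (𝕜 := ℝ)).preimage
        (continuous_fst.comp continuous_fst)).measurableSet
    · have : IsClosed {p : ((Fin (d + 1) → X) × X) × X |
          ∀ i, dist (p.1.1 i) p.2 = dist (p.1.1 0) p.2} := by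
        simp only [Set.ofPred_forall]
        exact isClosed_iInter fun i => isClosed_eq (by fun_prop) (by fun_prop)
      exact this.measurableSet
    · have : IsOpen {p : ((Fin (d + 1) → X) × X) × X | dist p.1.2 p.2 < dist (p.1.1 0) p.2} :=
        isOpen_lt (by fun_prop) (by fun_prop)
      exact this.measurableSet
  convert! hT.image_of_continuousOn_injOn continuous_fst.continuousOn ?_ using 1
  · ext p
    constructor
    · rintro ⟨hi, c, hc, hw⟩
      exact ⟨(p, c), ⟨hi, hc, hw⟩, rfl⟩
    · rintro ⟨⟨p, c⟩, ⟨hi, hc, hw⟩, rfl⟩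
      exact ⟨hi, c, hc, hw⟩
  · rintro ⟨p, c⟩ ⟨hi, hc, -⟩ ⟨q, c'⟩ ⟨hi', hc', -⟩ (rfl : p = q)
    exact Prod.ext rfl ((hi.eq_circumcenter_of_forall_dist_eq hc).trans
      (hi.eq_circumcenter_of_forall_dist_eq hc').symm)

variable {S : Type*} [MeasurableSpace S]

lemma IsPointProcess.measurableSet_adj {η : S → Set X} (hη : IsPointProcess η) :
    MeasurableSet {p : (S × X) × X | (delaunayGraph (η p.1.1)).Adj p.1.2 p.2} := by
  simp only [delaunayGraph_adj_iff]
  have hproc : IsPointProcess fun p : (S × X) × X => η p.1.1 := hη.comp (by fun_prop)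
  refine hproc.measurableSet_exists_tuple (G := {q : ((S × X) × X) × (Fin (d + 1) → X) |
    q.1.1.2 ≠ q.1.2 ∧ AffineIndependent ℝ q.2 ∧ (∀ w ∈ η q.1.1.1, ¬ InCircumball q.2 w) ∧
      (∃ i, q.2 i = q.1.1.2) ∧ ∃ j, q.2 j = q.1.2}) ?_
  have hproc' : IsPointProcess fun q : ((S × X) × X) × (Fin (d + 1) → X) => η q.1.1.1 :=
    hη.comp (by fun_prop)
  have hmeas : MeasurableSet {r : (((S × X) × X) × (Fin (d + 1) → X)) × X |
      AffineIndependent ℝ r.1.2 ∧ InCircumball r.1.2 r.2} :=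
    measurableSet_inCircumball.preimage
      (f := fun r : (((S × X) × X) × (Fin (d + 1) → X)) × X => (r.1.2, r.2)) (by fun_prop)
  -- Emptiness of the circumball is the negation of the existence of a point of the process inside
  -- it.
  have hempty := (hproc'.measurableSet_exists hmeas).compl
  have hind : MeasurableSet {q : ((S × X) × X) × (Fin (d + 1) → X) | AffineIndependent ℝ q.2} :=
    measurable_snd (isOpen_setOfPred_affineIndependent (𝕜 := ℝ)).measurableSet
  have hne : MeasurableSet {q : ((S × X) × X) × (Fin (d + 1) → X) | q.1.1.2 ≠ q.1.2} :=
    (measurableSet_eq_fun (by fun_prop) (by fun_prop)).compl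
  have hx : MeasurableSet {q : ((S × X) × X) × (Fin (d + 1) → X) | ∃ i, q.2 i = q.1.1.2} := by
    rw [Set.ofPred_exists]
    exact MeasurableSet.iUnion fun i => measurableSet_eq_fun (by fun_prop) (by fun_prop)
  have hy : MeasurableSet {q : ((S × X) × X) × (Fin (d + 1) → X) | ∃ i, q.2 i = q.1.2} := by
    rw [Set.ofPred_exists]
    exact MeasurableSet.iUnion fun i => measurableSet_eq_fun (by fun_prop) (by fun_prop)
  convert! hne.inter (hind.inter (hempty.inter (hx.inter hy))) using 1
  ext q
  simp only [Set.mem_ofPred_eq, Set.mem_inter_iff, Set.mem_compl_iff, not_exists, not_and]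
  tauto

/-- The degree is the mass that the counting kernel gives to a section of the measurable adjacency
relation. -/
lemma IsPointProcess.measurable_degree {η : S → Set X} (hη : IsPointProcess η) :
    Measurable fun p : S × X => degree (η p.1) p.2 := by
  have hproc : IsPointProcess fun p : S × X => η p.1 := hη.comp measurable_fst
  have := hproc.isSFiniteKernel
  have h1 := Kernel.measurable_kernel_prodMk_left (κ := hproc.kernel) hη.measurableSet_adj
  have h2 : ∀ p : S × X, hproc.kernel p
      (Prod.mk p ⁻¹' {p : (S × X) × X | (delaunayGraph (η p.1.1)).Adj p.1.2 p.2})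
      = (degree (η p.1) p.2 : ℝ≥0∞) := by
    intro p
    have h3 : Prod.mk p ⁻¹' {p : (S × X) × X | (delaunayGraph (η p.1.1)).Adj p.1.2 p.2}
      = (delaunayGraph (η p.1)).neighborSet p.2 := rfl
    have hc := (hη.locallyFinite p.1).countable
    rw [h3, hproc.kernel_apply, pointMeasure_apply _ hc
      (hc.mono (neighborSet_subset _ _)).measurableSet,
      Set.inter_eq_right.2 (neighborSet_subset _ _), degree]
  simp only [h2] at h1
  refine measurable_to_countable' fun k => ?_
  convert! h1 (measurableSet_singleton (k : ℝ≥0∞)) using 1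
  ext p
  simp

/-- The number of points of `χ` in `A` whose degree lies in `J`. -/
noncomputable def degreeCount (J : Set ℕ∞) (A χ : Set X) : ℝ≥0∞ :=
  ∑' x : ↥(χ ∩ A), {y | degree χ y ∈ J}.indicator (fun _ => 1) x.1

lemma degreeCount_eq_tsum (J : Set ℕ∞) (A χ : Set X) :
    degreeCount J A χ = ∑' x : χ, (A ∩ {y | degree χ y ∈ J}).indicator (fun _ => 1) x.1 := by
  rw [degreeCount, tsum_subtype (χ ∩ A) ({y | degree χ y ∈ J}.indicator fun _ => (1 : ℝ≥0∞)),
    tsum_subtype χ ((A ∩ {y | degree χ y ∈ J}).indicator fun _ => (1 : ℝ≥0∞))]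
  simp only [Set.indicator_indicator, Set.inter_assoc]

lemma degreeCount_eq_encard (J : Set ℕ∞) (A χ : Set X) :
    degreeCount J A χ = ((χ ∩ A ∩ {y | degree χ y ∈ J}).encard : ℝ≥0∞) := by
  rw [degreeCount, tsum_subtype (χ ∩ A) ({y | degree χ y ∈ J}.indicator fun _ => (1 : ℝ≥0∞)),
    Set.indicator_indicator, ← tsum_subtype, ENNReal.tsum_set_one]

lemma IsPointProcess.measurable_degreeCount {η : S → Set X} (hη : IsPointProcess η)
    (J : Set ℕ∞) {A : Set X} (hA : MeasurableSet A) :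
    Measurable fun s => degreeCount J A (η s) := by
  simp only [degreeCount_eq_tsum]
  refine hη.measurable_tsum
    (f := fun s x => (A ∩ {y | degree (η s) y ∈ J}).indicator (fun _ => 1) x) ?_
  exact measurable_one.indicator
    ((measurable_snd hA).inter (hη.measurable_degree (MeasurableSet.of_discrete (s := J))))

lemma degreeCount_preimage_add (J : Set ℕ∞) (A χ : Set X) (v : X) :
    degreeCount J ((v + ·) ⁻¹' A) ((v + ·) ⁻¹' χ) = degreeCount J A χ := by
  have : χ ∩ A ∩ {y | degree χ y ∈ J} = (v + ·) '' ((v + ·) ⁻¹' χ ∩ (v + ·) ⁻¹' A ∩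
      {y | degree ((v + ·) ⁻¹' χ) y ∈ J}) := by
    ext y
    simp [degree_preimage_add]
  rw [degreeCount_eq_encard, degreeCount_eq_encard, this, (add_right_injective v).encard_image]

end Delaunay

/-! ### The counts determine the law of the process; stationarity. -/

section Law

variable {d : ℕ} {Ω : Type*} [MeasurableSpace Ω] {P : Measure Ω}

local notation "X" => EuclideanSpace ℝ (Fin d)

/-- The mass at `⊤` is what the finite values leave of the total mass `1`. -/
lemma _root_.ENat.measure_ext {μ ν : Measure ℕ∞} [IsProbabilityMeasure μ] [IsProbabilityMeasure ν]
    (h : ∀ n : ℕ, μ {(n : ℕ∞)} = ν {(n : ℕ∞)}) : μ = ν := by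
  refine Measure.ext_of_singleton fun a => ?_
  induction a using ENat.recTopCoe with
  | coe n => exact h n
  | top =>
    have hc : ({⊤} : Set ℕ∞) = (⋃ n : ℕ, {(n : ℕ∞)})ᶜ := by
      ext a
      induction a using ENat.recTopCoe with
      | coe n => simp
      | top => simp
    have hd : Pairwise (Function.onFun Disjoint fun n : ℕ => ({(n : ℕ∞)} : Set ℕ∞)) := by
      intro m n hmn
      simpa [Function.onFun] using hmn
    rw [hc, prob_compl_eq_one_sub .of_discrete, prob_compl_eq_one_sub .of_discrete,
      measure_iUnion hd fun _ => .of_discrete, measure_iUnion hd fun _ => .of_discrete]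
    simp only [h]

lemma IsUnitPoissonProcess.map_count [IsProbabilityMeasure P] {η : Ω → Set X}
    (hη : IsUnitPoissonProcess η P) {A : Set X} (hA : MeasurableSet A) (hfin : volume A ≠ ∞) :
    P.map (fun ω => (η ω ∩ A).encard)
      = (poissonMeasure (volume A).toNNReal).map ((↑) : ℕ → ℕ∞) := by
  have hm := hη.measurable_count A hA
  have : IsProbabilityMeasure (P.map fun ω => (η ω ∩ A).encard) :=
    Measure.isProbabilityMeasure_map hm.aemeasurable
  have : IsProbabilityMeasure ((poissonMeasure (volume A).toNNReal).map ((↑) : ℕ → ℕ∞)) :=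
    Measure.isProbabilityMeasure_map Measurable.of_discrete.aemeasurable
  refine ENat.measure_ext fun n => ?_
  rw [Measure.map_apply hm .of_discrete, Measure.map_apply .of_discrete .of_discrete]
  have h1 : ((↑) : ℕ → ℕ∞) ⁻¹' {(n : ℕ∞)} = {n} := by
    ext k
    simp
  rw [h1, ← hη.law_count A hA hfin n]
  rfl

lemma IsUnitPoissonProcess.map_count_pi [IsProbabilityMeasure P] {η : Ω → Set X}
    (hη : IsUnitPoissonProcess η P) {ι : Type*} [Fintype ι] {A : ι → Set X}
    (hA : ∀ i, MeasurableSet (A i)) (hdisj : Pairwise (Function.onFun Disjoint A))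
    (hfin : ∀ i, volume (A i) ≠ ∞) :
    P.map (fun ω i => (η ω ∩ A i).encard)
      = Measure.pi fun i => (poissonMeasure (volume (A i)).toNNReal).map ((↑) : ℕ → ℕ∞) := by
  let e := Fintype.equivFin ι
  have h1 := hη.indep_count (Fintype.card ι) (fun i => A (e.symm i)) (fun i => hA _)
    (fun i j hij => hdisj (e.symm.injective.ne hij))
  have h2 : iIndepFun (fun i ω => (η ω ∩ A i).encard) P := by
    simpa using h1.precomp e.injective
  rw [iIndepFun_iff_map_fun_eq_pi_map fun i => (hη.measurable_count _ (hA i)).aemeasurable] at h2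
  rw [h2]
  simp only [hη.map_count (hA _) (hfin _)]

/-- The points that lie in the sets `A i` with `i ∈ T` and in no other set of the family. -/
def atom {ι : Type*} (A : ι → Set X) (T : Set ι) : Set X := {x | ∀ i, x ∈ A i ↔ i ∈ T}

lemma measurableSet_atom {ι : Type*} [Finite ι] {A : ι → Set X} (hA : ∀ i, MeasurableSet (A i))
    (T : Set ι) : MeasurableSet (atom A T) := by
  have : atom A T = ⋂ i, {x | x ∈ A i ↔ i ∈ T} := by
    ext x
    simp [atom]
  rw [this]
  refine MeasurableSet.iInter fun i => ?_
  by_cases hi : i ∈ T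
  · simp only [hi, iff_true]
    exact hA i
  · simp only [hi, iff_false]
    exact (hA i).compl

lemma disjoint_atom {ι : Type*} (A : ι → Set X) {T U : Set ι} (h : T ≠ U) :
    Disjoint (atom A T) (atom A U) :=
  Set.disjoint_left.2 fun _ hT hU => h (Set.ext fun i => (hT i).symm.trans (hU i))

lemma encard_inter_eq_finsum_atom {ι : Type*} [Finite ι] (A : ι → Set X) (χ : Set X) (i : ι) :
    (χ ∩ A i).encard = ∑ᶠ T : {T : Set ι // i ∈ T}, (χ ∩ atom A T).encard := by
  have hunion : χ ∩ A i = ⋃ T : {T : Set ι // i ∈ T}, χ ∩ atom A T := by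
    ext x
    simp only [Set.mem_inter_iff, Set.mem_iUnion]
    constructor
    · rintro ⟨hx, hi⟩
      exact ⟨⟨{j | x ∈ A j}, hi⟩, hx, fun j => Iff.rfl⟩
    · rintro ⟨T, hx, hT⟩
      exact ⟨hx, (hT i).2 T.2⟩
  rw [hunion]
  refine Set.encard_iUnion_of_finite fun T U hTU => ?_
  exact (disjoint_atom A (Subtype.coe_injective.ne hTU)).mono Set.inter_subset_right
    Set.inter_subset_right

/-- The sets `A i` may overlap, while independence concerns disjoint sets. Their counts are sums of
counts over the disjoint atoms, whose joint law is a product of Poisson laws. -/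
lemma IsUnitPoissonProcess.map_count_congr [IsProbabilityMeasure P] {η η' : Ω → Set X}
    (hη : IsUnitPoissonProcess η P) (hη' : IsUnitPoissonProcess η' P) {ι : Type*} [Fintype ι]
    {A : ι → Set X} (hA : ∀ i, MeasurableSet (A i)) (hfin : ∀ i, volume (A i) ≠ ∞) :
    P.map (fun ω i => (η ω ∩ A i).encard) = P.map (fun ω i => (η' ω ∩ A i).encard) := by
  -- The atom of `∅` is left out: it is the complement of all `A i`, has infinite volume when `d >
  -- 0`, and contributes to no count.
  have := Fintype.ofFinite {T : Set ι // T.Nonempty}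
  let I := {T : Set ι // T.Nonempty}
  let C : I → Set X := fun T => atom A T
  have hC : ∀ T, MeasurableSet (C T) := fun T => measurableSet_atom hA T
  have hdisj : Pairwise (Function.onFun Disjoint C) := by
    intro T U hTU
    exact disjoint_atom A (Subtype.coe_injective.ne hTU)
  have hCfin : ∀ T, volume (C T) ≠ ∞ := by
    rintro ⟨T, i, hi⟩
    exact measure_ne_top_of_subset (fun x hx => (hx i).2 hi) (hfin i)
  let g : (I → ℕ∞) → ι → ℕ∞ := fun c i => ∑ᶠ T : {T : Set ι // i ∈ T}, c ⟨T, i, T.2⟩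
  have hcount : ∀ χ : Set X, (fun i => (χ ∩ A i).encard) = g fun T => (χ ∩ C T).encard := by
    intro χ
    ext1 i
    exact encard_inter_eq_finsum_atom A χ i
  have hg : Measurable g := .of_discrete
  have hmap : ∀ {ξ : Ω → Set X}, IsUnitPoissonProcess ξ P →
      P.map (fun ω i => (ξ ω ∩ A i).encard)
        = (P.map fun ω T => (ξ ω ∩ C T).encard).map g := by
    intro ξ hξ
    rw [Measure.map_map hg (measurable_pi_lambda _ fun T => hξ.measurable_count _ (hC T))]
    exact congrArg (fun f => P.map f) (funext fun ω => hcount (ξ ω))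
  rw [hmap hη, hmap hη', hη.map_count_pi hC hdisj hCfin, hη'.map_count_pi hC hdisj hCfin]

/-- The bounded Borel sets. -/
abbrev BoundedBorel (d : ℕ) : Type :=
  {A : Set (EuclideanSpace ℝ (Fin d)) // MeasurableSet A ∧ Bornology.IsBounded A}

/-- The space of locally finite sets. -/
def Configuration (d : ℕ) : Type := {χ : Set (EuclideanSpace ℝ (Fin d)) // LocallyFiniteSet χ}

/-- The numbers of points of a configuration in the bounded Borel sets. -/
noncomputable def Configuration.counts (χ : Configuration d) (A : BoundedBorel d) : ℕ∞ :=
  (χ.1 ∩ A.1).encard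

/-- The σ-algebra on the configurations generated by the numbers of points in bounded Borel
sets. -/
noncomputable instance : MeasurableSpace (Configuration d) :=
  MeasurableSpace.comap Configuration.counts inferInstance

lemma isPointProcess_configuration : IsPointProcess fun χ : Configuration d => χ.1 :=
  ⟨fun χ => χ.2, fun A hA hb => (measurable_pi_apply (⟨A, hA, hb⟩ : BoundedBorel d)).comp
    (comap_measurable Configuration.counts)⟩

/-- Equal finite-dimensional laws give equal laws of the whole family of counts, by uniqueness of
projective limits. The counts generate the σ-algebra on configurations, so every measurable
functional has the same integral. -/
lemma IsUnitPoissonProcess.lintegral_comp_eq [IsProbabilityMeasure P] {η η' : Ω → Set X}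
    (hη : IsUnitPoissonProcess η P) (hη' : IsUnitPoissonProcess η' P) {f : Set X → ℝ≥0∞}
    (hf : Measurable fun χ : Configuration d => f χ.1) :
    ∫⁻ ω, f (η ω) ∂P = ∫⁻ ω, f (η' ω) ∂P := by
  let conf : ∀ {ξ : Ω → Set X}, IsUnitPoissonProcess ξ P → Ω → Configuration d :=
    fun {ξ} hξ ω => ⟨ξ ω, hξ.locallyFinite ω⟩
  let N : (Ω → Set X) → Ω → BoundedBorel d → ℕ∞ := fun ξ ω A => (ξ ω ∩ A.1).encard
  have hN : ∀ {ξ : Ω → Set X}, IsUnitPoissonProcess ξ P → Measurable (N ξ) := fun hξ =>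
    measurable_pi_lambda _ fun A => hξ.measurable_count _ A.2.1
  have hconf : ∀ {ξ : Ω → Set X} (hξ : IsUnitPoissonProcess ξ P), Measurable (conf hξ) :=
    fun hξ => measurable_comap_iff.2 (hN hξ)
  have hlaw : P.map (N η) = P.map (N η') := by
    refine IsProjectiveLimit.unique (P := fun I => (P.map (N η')).map I.restrict) ?_
      fun I => rfl
    intro I
    dsimp only
    rw [Measure.map_map (by fun_prop) (hN hη), Measure.map_map (by fun_prop) (hN hη')]
    exact hη.map_count_congr hη' (A := fun i : I => i.1.1) (fun i => i.1.2.1)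
      fun i => i.1.2.2.measure_lt_top.ne
  have heq : P.map (conf hη) = P.map (conf hη') := by
    ext F hF
    obtain ⟨G, hG, rfl⟩ := hF
    have hF : MeasurableSet (Configuration.counts (d := d) ⁻¹' G) := ⟨G, hG, rfl⟩
    rw [Measure.map_apply (hconf hη) hF, Measure.map_apply (hconf hη') hF]
    have := congrArg (fun μ => μ G) hlaw
    simp only [Measure.map_apply (hN hη) hG, Measure.map_apply (hN hη') hG] at this
    exact this
  calc ∫⁻ ω, f (η ω) ∂P = ∫⁻ χ, f χ.1 ∂(P.map (conf hη)) := (lintegral_map hf (hconf hη)).symm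
    _ = ∫⁻ ω, f (η' ω) ∂P := by rw [heq, lintegral_map hf (hconf hη')]

lemma IsUnitPoissonProcess.preimage_add {η : Ω → Set X} (hη : IsUnitPoissonProcess η P) (v : X) :
    IsUnitPoissonProcess (fun ω => (v + ·) ⁻¹' η ω) P := by
  have hcard : ∀ (χ A : Set X), ((v + ·) ⁻¹' χ ∩ A).encard = (χ ∩ (-v + ·) ⁻¹' A).encard := by
    intro χ A
    rw [← (add_right_injective v).encard_image]
    congr 1
    ext y
    simp
  have hA' : ∀ A : Set X, MeasurableSet A → MeasurableSet ((-v + ·) ⁻¹' A) := fun A hA =>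
    measurable_const_add _ hA
  refine ⟨fun ω => (hη.locallyFinite ω).preimage_add v, fun A hA => ?_, fun A hA hfin n => ?_,
    fun m A hA hdisj => ?_⟩
  · simpa only [hcard] using hη.measurable_count _ (hA' A hA)
  · have h := hη.law_count _ (hA' A hA) (by rwa [measure_preimage_add]) n
    simpa only [hcard, measure_preimage_add] using h
  · have h := hη.indep_count m _ (fun i => hA' _ (hA i))
      (fun i j hij => (hdisj hij).preimage (-v + ·))
    simpa only [hcard] using h

end Law

/-! ### The Poisson tail, the intensity of high-degree points and the truncation inequality. -/

section Intensity

variable {d : ℕ} {Ω : Type*} [MeasurableSpace Ω] {P : Measure Ω}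

local notation "X" => EuclideanSpace ℝ (Fin d)

lemma lintegral_poissonMeasure_tail_le (r : NNReal) (h : ℝ) :
    ∫⁻ n : ℕ, {n : ℕ | ENNReal.ofReal (h + 1) < n}.indicator (fun n => (n : ℝ≥0∞)) n
        ∂poissonMeasure r
      ≤ ENNReal.ofReal (r * Real.exp (r * (Real.exp 1 - 1) - h)) := by
  -- The shift uses `(n + 1) p(n + 1) = r p(n)` for Poisson weights; on the event `n > h` the factor
  -- `exp (n - h) ≥ 1` is inserted, and the resulting exponential series can be summed.
  have hle : ∀ n : ℕ, {n : ℕ | ENNReal.ofReal (h + 1) < n}.indicator (fun n => (n : ℝ≥0∞)) (n + 1)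
      * poissonMeasure r {n + 1}
      ≤ ENNReal.ofReal (r * Real.exp (-r - h) * ((r * Real.exp 1) ^ n / n.factorial)) := by
    intro n
    by_cases hn : ENNReal.ofReal (h + 1) < ((n + 1 : ℕ) : ℝ≥0∞)
    · rw [Set.indicator_of_mem (show (n + 1) ∈ {n : ℕ | ENNReal.ofReal (h + 1) < n} from hn),
        poissonMeasure_singleton, ← ENNReal.ofReal_natCast, ← ENNReal.ofReal_mul (by positivity)]
      refine ENNReal.ofReal_le_ofReal ?_
      have hn' : h < n := by
        rw [ENNReal.ofReal_lt_natCast (by simp)] at hn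
        push_cast at hn
        linarith
      have hexp : (1 : ℝ) ≤ Real.exp (n - h) := Real.one_le_exp (by linarith)
      have h1 : ((n + 1 : ℕ) : ℝ) * (Real.exp (-r) * (r : ℝ) ^ (n + 1) / (n + 1).factorial)
          = r * Real.exp (-r) * ((r : ℝ) ^ n / n.factorial) := by
        rw [Nat.factorial_succ]
        push_cast
        field_simp
        ring
      have h2 : r * Real.exp (-r - h) * ((r * Real.exp 1) ^ n / n.factorial)
          = r * Real.exp (-r) * ((r : ℝ) ^ n / n.factorial) * Real.exp (n - h) := by
        rw [mul_pow, ← Real.exp_nat_mul, mul_one, sub_eq_add_neg (-(r : ℝ)), Real.exp_add,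
          sub_eq_add_neg (n : ℝ), Real.exp_add]
        ring
      rw [h1, h2]
      exact le_mul_of_one_le_right (by positivity) hexp
    · rw [Set.indicator_of_notMem (show (n + 1) ∉ {n : ℕ | ENNReal.ofReal (h + 1) < n} from hn)]
      simp
  have hsum : HasSum (fun n : ℕ => r * Real.exp (-r - h) * ((r * Real.exp 1) ^ n / n.factorial))
      (r * Real.exp (r * (Real.exp 1 - 1) - h)) := by
    have := (NormedSpace.expSeries_div_hasSum_exp (r * Real.exp 1)).mul_left
      (r * Real.exp (-r - h))
    rw [← Real.exp_eq_exp_ℝ, mul_assoc (r : ℝ), ← Real.exp_add] at this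
    convert! this using 3
    ring
  rw [lintegral_countable', tsum_eq_zero_add' ENNReal.summable]
  have h0 : {n : ℕ | ENNReal.ofReal (h + 1) < n}.indicator (fun n => (n : ℝ≥0∞)) 0 = 0 :=
    Set.indicator_apply_eq_zero.2 fun _ => by simp
  rw [h0, zero_mul, zero_add]
  refine (ENNReal.tsum_le_tsum hle).trans ?_
  rw [← ENNReal.ofReal_tsum_of_nonneg (fun n => by positivity) hsum.summable, hsum.tsum_eq]

lemma IsUnitPoissonProcess.lintegral_count_tail_le [IsProbabilityMeasure P] {η : Ω → Set X}
    (hη : IsUnitPoissonProcess η P) {A : Set X} (hA : MeasurableSet A) (hfin : volume A ≠ ∞)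
    (h : ℝ) :
    ∫⁻ ω, {ω | ENNReal.ofReal (h + 1) < ((η ω ∩ A).encard : ℝ≥0∞)}.indicator
        (fun ω => ((η ω ∩ A).encard : ℝ≥0∞)) ω ∂P
      ≤ ENNReal.ofReal (volume.real A *
          Real.exp (volume.real A * (Real.exp 1 - 1) - h)) := by
  let φ : ℕ∞ → ℝ≥0∞ := {a : ℕ∞ | ENNReal.ofReal (h + 1) < (a : ℝ≥0∞)}.indicator fun a => a
  have hφ : Measurable φ := .of_discrete
  calc _ = ∫⁻ a, φ a ∂(P.map fun ω => (η ω ∩ A).encard) :=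
        (lintegral_map hφ (hη.measurable_count A hA)).symm
    _ = ∫⁻ n : ℕ, φ n ∂poissonMeasure (volume A).toNNReal := by
        rw [hη.map_count hA hfin, lintegral_map hφ .of_discrete]
    _ ≤ _ := lintegral_poissonMeasure_tail_le _ h

lemma IsUnitPoissonProcess.lintegral_count_lt_top [IsProbabilityMeasure P] {η : Ω → Set X}
    (hη : IsUnitPoissonProcess η P) {A : Set X} (hA : MeasurableSet A) (hfin : volume A ≠ ∞) :
    ∫⁻ ω, ((η ω ∩ A).encard : ℝ≥0∞) ∂P < ∞ := by
  -- With `h = -1` the threshold is `0`, so the tail is the full expectation.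
  refine lt_of_le_of_lt (le_of_eq_of_le ?_ (hη.lintegral_count_tail_le hA hfin (-1)))
    ENNReal.ofReal_lt_top
  refine MeasureTheory.lintegral_congr fun ω => ?_
  simp only [Set.indicator_apply, Set.mem_ofPred_eq, neg_add_cancel, ENNReal.ofReal_zero]
  split_ifs with h0
  · rfl
  · exact nonpos_iff_eq_zero.1 (not_lt.1 h0)

lemma IsUnitPoissonProcess.isPointProcess {η : Ω → Set X} (hη : IsUnitPoissonProcess η P) :
    IsPointProcess η :=
  ⟨hη.locallyFinite, fun A hA _ => hη.measurable_count A hA⟩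

lemma degreeCount_le_encard (J : Set ℕ∞) (A χ : Set X) :
    degreeCount J A χ ≤ ((χ ∩ A).encard : ℝ≥0∞) := by
  rw [degreeCount_eq_encard]
  exact_mod_cast Set.encard_le_encard Set.inter_subset_left

/-- The measure that gives to `A` the expected number of points of `η` in `A` whose degree lies
in `J`. -/
noncomputable def degreeIntensity (η : Ω → Set X) (P : Measure Ω) (J : Set ℕ∞) : Measure X :=
  P.bind fun ω => (pointMeasure (η ω)).restrict {y | degree (η ω) y ∈ J}

lemma IsUnitPoissonProcess.degreeIntensity_apply {η : Ω → Set X}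
    (hη : IsUnitPoissonProcess η P) (J : Set ℕ∞) {A : Set X} (hA : MeasurableSet A) :
    degreeIntensity η P J A = ∫⁻ ω, degreeCount J A (η ω) ∂P := by
  have hpp := hη.isPointProcess
  have hval : ∀ ω {A : Set X}, MeasurableSet A →
      (pointMeasure (η ω)).restrict {y | degree (η ω) y ∈ J} A = degreeCount J A (η ω) := by
    intro ω A hA
    have hJ : MeasurableSet {y | degree (η ω) y ∈ J} :=
      (hpp.measurable_degree.comp measurable_prodMk_left) (MeasurableSet.of_discrete (s := J))
    rw [Measure.restrict_apply hA, pointMeasure_apply _ (hη.locallyFinite ω).countable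
      (hA.inter hJ), degreeCount_eq_encard, Set.inter_assoc]
  have hmeas : Measurable fun ω => (pointMeasure (η ω)).restrict {y | degree (η ω) y ∈ J} := by
    refine Measure.measurable_of_measurable_coe _ fun A hA => ?_
    simpa only [hval _ hA] using hpp.measurable_degreeCount J hA
  rw [degreeIntensity, Measure.bind_apply hA hmeas.aemeasurable]
  simp only [hval _ hA]

/-- Uniqueness of Haar measure: finiteness on compact sets comes from the Poisson mean, and
invariance from comparing `η` with its translate. -/
lemma IsUnitPoissonProcess.exists_degreeIntensity_eq [IsProbabilityMeasure P] {η : Ω → Set X}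
    (hη : IsUnitPoissonProcess η P) (J : Set ℕ∞) :
    ∃ c : NNReal, degreeIntensity η P J = c • volume := by
  have : IsFiniteMeasureOnCompacts (degreeIntensity η P J) := by
    refine ⟨fun K hK => ?_⟩
    rw [hη.degreeIntensity_apply J hK.measurableSet]
    exact (lintegral_mono fun ω => degreeCount_le_encard J K (η ω)).trans_lt
      (hη.lintegral_count_lt_top hK.measurableSet hK.measure_lt_top.ne)
  have : (degreeIntensity η P J).IsAddLeftInvariant := by
    refine ⟨fun v => ?_⟩
    ext A hA
    have hv : MeasurableSet ((v + ·) ⁻¹' A) := measurable_const_add v hA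
    rw [Measure.map_apply (measurable_const_add v) hA, hη.degreeIntensity_apply J hv,
      hη.degreeIntensity_apply J hA, hη.lintegral_comp_eq (hη.preimage_add v)
        (isPointProcess_configuration.measurable_degreeCount J hv)]
    simp only [degreeCount_preimage_add]
  exact ⟨_, Measure.isAddLeftInvariant_eq_smul _ volume⟩

/-- Only an inequality, since points of infinite degree count on the right alone. This direction
suffices, so finiteness of degrees need not be proved. -/
lemma tsum_degreeCount_le (k : ℕ) (A χ : Set X) :
    ∑' j : ℕ, degreeCount {(j : ℕ∞)} A χ * (Set.Ici k).indicator 1 j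
      ≤ degreeCount (Set.Ici (k : ℕ∞)) A χ := by
  simp only [degreeCount, ← ENNReal.tsum_mul_right]
  rw [ENNReal.tsum_comm]
  refine ENNReal.tsum_le_tsum fun x => ?_
  by_cases hx : ∃ j : ℕ, degree χ x.1 = j
  · obtain ⟨j, hj⟩ := hx
    rw [tsum_eq_single j]
    · by_cases hk : k ≤ j <;> simp [hj, hk]
    · intro i hi
      have : (j : ℕ∞) ≠ i := by exact_mod_cast hi.symm
      simp [Set.indicator_apply, hj, this]
  · push Not at hx
    have : ∀ j : ℕ, {y | degree χ y ∈ ({(j : ℕ∞)} : Set ℕ∞)}.indicator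
        (fun _ => (1 : ℝ≥0∞)) x.1 = 0 := fun j =>
      Set.indicator_of_notMem (s := {y | degree χ y ∈ ({(j : ℕ∞)} : Set ℕ∞)}) (hx j) _
    simp only [this, zero_mul, tsum_zero, zero_le]

lemma IsUnitPoissonProcess.typicalDegreeLaw_Ici_le {η : Ω → Set X}
    (hη : IsUnitPoissonProcess η P) {A : Set X} (hA : MeasurableSet A) (k : ℕ) :
    typicalDegreeLaw η P A (Set.Ici k)
      ≤ (volume A)⁻¹ * degreeIntensity η P (Set.Ici (k : ℕ∞)) A := by
  have hlaw : typicalDegreeLaw η P A (Set.Ici k) = ∑' j : ℕ, (volume A)⁻¹ *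
      ∫⁻ ω, degreeCount {(j : ℕ∞)} A (η ω) * (Set.Ici k).indicator 1 j ∂P := by
    rw [typicalDegreeLaw, Measure.sum_apply _ .of_discrete]
    refine tsum_congr fun j => ?_
    rw [Measure.smul_apply, Measure.dirac_apply, smul_eq_mul, mul_assoc,
      lintegral_mul_const _ (hη.isPointProcess.measurable_degreeCount _ hA)]
    rfl
  rw [hlaw, ENNReal.tsum_mul_left, hη.degreeIntensity_apply _ hA, ← lintegral_tsum fun j =>
    ((hη.isPointProcess.measurable_degreeCount _ hA).mul_const _).aemeasurable]
  gcongr with ω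
  exact tsum_degreeCount_le k A (η ω)

lemma degreeCount_le_add {S : Type*} (k : ℕ) (B : Set X) (η : S → Set X) (h : ℝ) (ω : S) :
    degreeCount (Set.Ici (k : ℕ∞)) B (η ω)
      ≤ {ω | (k : WithBot ℕ∞) ≤ maxDegree (η ω) B}.indicator
          (fun _ => ENNReal.ofReal (h + 1)) ω +
        {ω | ENNReal.ofReal (h + 1) < ((η ω ∩ B).encard : ℝ≥0∞)}.indicator
          (fun ω => ((η ω ∩ B).encard : ℝ≥0∞)) ω := by
  have hle := degreeCount_le_encard (Set.Ici (k : ℕ∞)) B (η ω)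
  by_cases hN : ENNReal.ofReal (h + 1) < ((η ω ∩ B).encard : ℝ≥0∞)
  · rw [Set.indicator_of_mem (s := {ω | ENNReal.ofReal (h + 1) < ((η ω ∩ B).encard : ℝ≥0∞)}) hN]
    exact hle.trans le_add_self
  rcases (η ω ∩ B ∩ {y | degree (η ω) y ∈ Set.Ici (k : ℕ∞)}).eq_empty_or_nonempty with
    hempty | ⟨x, hx, hdeg⟩
  · rw [degreeCount_eq_encard, hempty]
    simp
  · have hmax : (k : WithBot ℕ∞) ≤ maxDegree (η ω) B := by
      refine le_trans ?_ (le_iSup₂ (f := fun x (_ : x ∈ η ω ∩ B) =>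
        (degree (η ω) x : WithBot ℕ∞)) x hx)
      exact WithBot.coe_le_coe.2 hdeg
    rw [Set.indicator_of_mem (s := {ω | (k : WithBot ℕ∞) ≤ maxDegree (η ω) B}) hmax]
    exact (hle.trans (not_lt.1 hN)).trans le_self_add

lemma IsUnitPoissonProcess.degreeIntensity_Ici_le [IsProbabilityMeasure P] {η : Ω → Set X}
    (hη : IsUnitPoissonProcess η P) {B : Set X} (hB : MeasurableSet B) (hfin : volume B ≠ ∞)
    (k : ℕ) (h : ℝ) :
    degreeIntensity η P (Set.Ici (k : ℕ∞)) B
      ≤ ENNReal.ofReal (h + 1) * P {ω | (k : WithBot ℕ∞) ≤ maxDegree (η ω) B} +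
        ENNReal.ofReal (volume.real B * Real.exp (volume.real B * (Real.exp 1 - 1) - h)) := by
  have hm : Measurable fun ω => ((η ω ∩ B).encard : ℝ≥0∞) :=
    (Measurable.of_discrete (f := fun k : ℕ∞ => (k : ℝ≥0∞))).comp (hη.measurable_count B hB)
  rw [hη.degreeIntensity_apply _ hB]
  refine (lintegral_mono (degreeCount_le_add k B η h)).trans ?_
  rw [lintegral_add_right _ (hm.indicator (measurableSet_lt measurable_const hm))]
  -- The bound for the integral of the indicator needs no measurability of the event on the maximal
  -- degree.
  exact add_le_add (lintegral_indicator_const_le _ _) (hη.lintegral_count_tail_le hB hfin h)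

end Intensity

end PoissonDelaunay

/-! ### Conclusion: comparison of the two bounds in real numbers. -/

theorem mainTheorem8 {d : ℕ} (hd : 2 ≤ d)
    {Ω : Type*} [MeasurableSpace Ω] (P : Measure Ω) [IsProbabilityMeasure P]
    (η : Ω → Set (EuclideanSpace ℝ (Fin d)))
    (hη : PoissonDelaunay.IsUnitPoissonProcess η P)
    -- the Borel set through which the typical degree is defined
    (B₀ : Set (EuclideanSpace ℝ (Fin d))) (hB₀ : MeasurableSet B₀)
    (hB₀_pos : 0 < volume B₀) (hB₀_fin : volume B₀ < ∞)
    (B : Set (EuclideanSpace ℝ (Fin d))) (hB : MeasurableSet B)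
    (hB_pos : 0 < volume B) (hB_fin : volume B < ∞)
    (k : ℕ) (h : ℝ) (hh : 1 ≤ h) :
    P.real {ω | (k : WithBot ℕ∞) ≤ PoissonDelaunay.maxDegree (η ω) B} ≥
      volume.real B / (h + 1) *
        ((PoissonDelaunay.typicalDegreeLaw η P B₀).real (Set.Ici k) -
          Real.exp (-(volume.real B * (1 - Real.exp 1 + h / volume.real B)))) := by
  have hV : 0 < volume.real B := ENNReal.toReal_pos hB_pos.ne' hB_fin.ne
  have hexponent : -(volume.real B * (1 - Real.exp 1 + h / volume.real B))
      = volume.real B * (Real.exp 1 - 1) - h := by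
    field_simp
    ring
  rw [hexponent]
  set E := Real.exp (volume.real B * (Real.exp 1 - 1) - h)
  set Q := {ω | (k : WithBot ℕ∞) ≤ PoissonDelaunay.maxDegree (η ω) B}
  obtain ⟨c, hc⟩ := hη.exists_degreeIntensity_eq (Set.Ici (k : ℕ∞))
  have hlaw : PoissonDelaunay.typicalDegreeLaw η P B₀ (Set.Ici k) ≤ c := by
    refine (hη.typicalDegreeLaw_Ici_le hB₀ k).trans_eq ?_
    rw [hc, Measure.smul_apply, ENNReal.smul_def, smul_eq_mul, mul_left_comm,
      ENNReal.inv_mul_cancel hB₀_pos.ne' hB₀_fin.ne, mul_one]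
  have hp : (PoissonDelaunay.typicalDegreeLaw η P B₀).real (Set.Ici k) ≤ c :=
    ENNReal.toReal_le_coe_of_le_coe hlaw
  have hint := hη.degreeIntensity_Ici_le hB hB_fin.ne k h
  rw [hc, Measure.smul_apply, ENNReal.smul_def, smul_eq_mul] at hint
  have hreal : c * volume.real B ≤ (h + 1) * P.real Q + volume.real B * E := by
    have hne : ENNReal.ofReal (h + 1) * P Q ≠ ∞ :=
      ENNReal.mul_ne_top ENNReal.ofReal_ne_top (measure_ne_top _ _)
    have := ENNReal.toReal_mono (ENNReal.add_ne_top.2 ⟨hne, ENNReal.ofReal_ne_top⟩) hint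
    rwa [ENNReal.toReal_add hne ENNReal.ofReal_ne_top, ENNReal.toReal_mul, ENNReal.toReal_mul,
      ENNReal.toReal_ofReal (by linarith), ENNReal.toReal_ofReal (by positivity)] at this
  have h1 : (PoissonDelaunay.typicalDegreeLaw η P B₀).real (Set.Ici k) * volume.real B ≤
      c * volume.real B :=
    mul_le_mul_of_nonneg_right hp hV.le
  rw [ge_iff_le, div_mul_eq_mul_div, div_le_iff₀ (by linarith)]
  linarith
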